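/- For a finite simple connected graph $G$ with $n$ vertices, call a nonempty set $S\subseteq V(G)$ a connected set if the induced subgraph $G[S]$ is connected. Let $N(G)$ be the number of connected sets of $G$, and put $c(G)=\frac12\sqrt[n]{N(G)}$. Let $\mathcal G_3$ be the set of finite connected cubic (that is, $3$-regular) simple graphs, up to isomorphism, and let $$c_3:=\limsup_{G\in\mathcal G_3,\ |V(G)|\to\infty}c(G).$$ Then $$0.813<c_3<0.9781.$$ -/

import Mathlib

open Filter

/-- `N(G)`: the number of connected sets of `G`, i.e. of sets `S` of vertices whose induced
subgraph `G[S]` is connected (`SimpleGraph.Connected` includes that `S` is nonempty). -/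
noncomputable def numConnectedSets {V : Type*} (G : SimpleGraph V) : ℕ :=
  {S : Set V | (G.induce S).Connected}.ncard

/-- `c(G) = (1/2) * N(G)^(1/n)`, where `n` is the number of vertices of `G`. -/
noncomputable def connGrowth {V : Type*} (G : SimpleGraph V) : ℝ :=
  (1 / 2) * (numConnectedSets G : ℝ) ^ (1 / (Nat.card V : ℝ))

open Classical in
/-- The finite connected `d`-regular graphs; every one of them is, up to isomorphism, a graph
with vertex set `Fin n`. -/
structure ConnRegularGraph (d : ℕ) where
  order : ℕ
  graph : SimpleGraph (Fin order)
  connected : graph.Connected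
  regular : graph.IsRegularOfDegree d

/-- `c_d`: the limit superior of `c(G)` over the finite connected `d`-regular graphs `G`, as the
number of vertices of `G` tends to infinity. -/
noncomputable def regularGrowthConst (d : ℕ) : ℝ :=
  limsup (fun G : ConnRegularGraph d => connGrowth G.graph)
    (comap (fun G : ConnRegularGraph d => G.order) atTop)

/-! Upper bound: a connected set with more than one vertex has no isolated vertex. In a uniformly
random vertex set of a cubic graph, a given vertex is isolated with probability 1/16, and two
adjacent vertices are never both isolated, so an edge has no isolated end with probability 7/8.
These edge events are dependent, but each coordinate influences at most 18 ordered edges. Finner's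
inequality (`listAvg_prod_rpow_le`) with weight 1/18 on each of the 3n ordered edges bounds the
probability of no isolated vertex by (7/8)^(3n/18). Hence N(G) ≤ n + 2^n (7/8)^(n/6), and
(7/8)^(1/6) < 0.978.

Lower bound: close copies of a 10-vertex block with two ports into a cubic ring. Connected subsets
of the block containing both ports can be chosen independently in each copy, and their union is
connected. There are 134 of them, so N(G) ≥ 134^(n/10), and 134^(1/10)/2 > 0.813. -/

/-! ### Averages on the discrete cube and Finner's inequality -/

section Averaging

variable {V : Type*} [DecidableEq V]

/-- The average of `h` over the two values of the coordinate `x`. -/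
noncomputable def coordAvg (x : V) (h : (V → Bool) → ℝ) (s : V → Bool) : ℝ :=
  (h (Function.update s x true) + h (Function.update s x false)) / 2

/-- The average of `h` over all coordinates in a list. -/
noncomputable def listAvg : List V → ((V → Bool) → ℝ) → (V → Bool) → ℝ
  | [], h => h
  | x :: l, h => coordAvg x (listAvg l h)

/-- `h` does not depend on the coordinate `x`. -/
def CoordInvariant (x : V) (h : (V → Bool) → ℝ) : Prop :=
  ∀ s b, h (Function.update s x b) = h s

theorem CoordInvariant.coordAvg {x : V} {h : (V → Bool) → ℝ} (hx : CoordInvariant x h) (y : V) :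
    CoordInvariant x (coordAvg y h) := by
  intro s b
  by_cases hxy : x = y
  · subst hxy
    simp [_root_.coordAvg]
  · simp only [_root_.coordAvg]
    rw [Function.update_comm hxy, Function.update_comm hxy, hx, hx]

theorem coordAvg_invariant (x : V) (h : (V → Bool) → ℝ) : CoordInvariant x (coordAvg x h) := by
  intro s b
  simp [coordAvg]

theorem CoordInvariant.listAvg {x : V} {h : (V → Bool) → ℝ} (hx : CoordInvariant x h)
    (l : List V) : CoordInvariant x (listAvg l h) := by
  induction l with
  | nil => exact hx
  | cons y l ih => exact ih.coordAvg y

theorem listAvg_invariant {x : V} {l : List V} (hx : x ∈ l) (h : (V → Bool) → ℝ) :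
    CoordInvariant x (listAvg l h) := by
  induction l with
  | nil => simp at hx
  | cons y l ih =>
    rcases List.mem_cons.1 hx with rfl | hx
    · exact coordAvg_invariant _ _
    · exact (ih hx).coordAvg y

theorem listAvg_nonneg {h : (V → Bool) → ℝ} (h0 : ∀ s, 0 ≤ h s) (l : List V) (s : V → Bool) :
    0 ≤ listAvg l h s := by
  induction l generalizing s with
  | nil => exact h0 s
  | cons y l ih =>
    have := ih (Function.update s y true)
    have := ih (Function.update s y false)
    simp only [listAvg, coordAvg]
    linarith

/-- Flipping the coordinate `x` is an involution of the cube, so it preserves the total. -/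
theorem sum_coordAvg [Fintype V] (x : V) (h : (V → Bool) → ℝ) :
    ∑ s, coordAvg x h s = ∑ s, h s := by
  have hinv : Function.Involutive (fun s : V → Bool => Function.update s x (!s x)) := by
    intro s
    simp
  have h1 : ∀ s, coordAvg x h s = (h s + h (Function.update s x (!s x))) / 2 := by
    intro s
    have hs : Function.update s x (s x) = s := Function.update_eq_self x s
    unfold coordAvg
    cases hb : s x <;> rw [hb] at hs <;> rw [hs] <;> simp [add_comm]
  have h2 : ∑ s, h (Function.update s x (!s x)) = ∑ s, h s :=
    Equiv.sum_comp hinv.toPerm h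
  simp_rw [h1]
  rw [← Finset.sum_div, Finset.sum_add_distrib, h2]
  ring

theorem sum_listAvg [Fintype V] (l : List V) (h : (V → Bool) → ℝ) :
    ∑ s, listAvg l h s = ∑ s, h s := by
  induction l with
  | nil => rfl
  | cons x l ih => simp only [listAvg, sum_coordAvg, ih]

theorem eq_of_forall_coordInvariant [Fintype V] {h : (V → Bool) → ℝ}
    (hh : ∀ x, CoordInvariant x h) (s t : V → Bool) : h s = h t := by
  have key : ∀ T : Finset V, h (T.piecewise t s) = h s := by
    intro T
    induction T using Finset.induction_on with
    | empty => simp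
    | insert a T _ ih => rw [Finset.piecewise_insert, hh, ih]
  have := key Finset.univ
  rw [Finset.piecewise_univ] at this
  exact this.symm

/-- Averaging over every coordinate leaves a constant function with the same total; this turns
iterated averages back into counts. -/
theorem two_pow_mul_listAvg_univ [Fintype V] (h : (V → Bool) → ℝ) (s : V → Bool) :
    2 ^ Fintype.card V * listAvg Finset.univ.toList h s = ∑ t, h t := by
  rw [← sum_listAvg Finset.univ.toList h]
  have : ∀ t, listAvg Finset.univ.toList h t = listAvg Finset.univ.toList h s := fun t =>
    eq_of_forall_coordInvariant (fun x => listAvg_invariant (by simp) h) t s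
  simp [this]

/-- Hölder's inequality on a space of two equiprobable points, for total weight at most one. -/
theorem prod_rpow_avg_le {ι : Type*} (I : Finset ι) (a b : ι → ℝ) (ha : ∀ i, 0 ≤ a i)
    (hb : ∀ i, 0 ≤ b i) {w : ℝ} (hw : 0 < w) (hI : I.card * w ≤ 1) :
    (∏ i ∈ I, a i ^ w + ∏ i ∈ I, b i ^ w) / 2 ≤ ∏ i ∈ I, ((a i + b i) / 2) ^ w := by
  classical
  -- Each factor will be normalised by its mean; a zero mean makes both values zero, and then both
  -- products vanish.
  by_cases hz : ∃ i ∈ I, a i + b i = 0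
  · obtain ⟨i, hi, h0⟩ := hz
    have h1 : a i = 0 := by linarith [ha i, hb i]
    have h2 : b i = 0 := by linarith [ha i, hb i]
    rw [Finset.prod_eq_zero hi (by rw [h1, Real.zero_rpow hw.ne']),
      Finset.prod_eq_zero hi (by rw [h2, Real.zero_rpow hw.ne'])]
    simp only [add_zero, zero_div]
    exact Finset.prod_nonneg fun i _ => Real.rpow_nonneg (by linarith [ha i, hb i]) _
  · push Not at hz
    have hm : ∀ i ∈ I, 0 < (a i + b i) / 2 := by
      intro i hi
      have := lt_of_le_of_ne (add_nonneg (ha i) (hb i)) (hz i hi).symm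
      linarith
    have key : ∀ c : ι → ℝ, (∀ i, 0 ≤ c i) → ∏ i ∈ I, c i ^ w ≤
        (∏ i ∈ I, ((a i + b i) / 2) ^ w) *
          (∑ i ∈ I, w * (c i / ((a i + b i) / 2)) + (1 - I.card * w)) := by
      intro c hc
      -- Weighted AM-GM needs total weight one: the extra index `none` carries the leftover weight
      -- with value 1.
      have h1 := Real.geom_mean_le_arith_mean_weighted (Finset.insertNone I)
        (fun o => o.elim (1 - I.card * w) (fun _ => w))
        (fun o => o.elim 1 (fun i => if i ∈ I then c i / ((a i + b i) / 2) else 0))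
        (by
          intro o _
          cases o with
          | none => simpa using hI
          | some i => exact hw.le)
        (by simp [Finset.sum_insertNone])
        (by
          intro o _
          cases o with
          | none => simp
          | some i =>
            simp only [Option.elim]
            split_ifs with hi
            · exact div_nonneg (hc i) (hm i hi).le
            · exact le_rfl)
      simp only [Finset.prod_insertNone, Finset.sum_insertNone, Option.elim, Real.one_rpow,
        one_mul, mul_one] at h1
      have h2 : ∏ i ∈ I, c i ^ w = (∏ i ∈ I, ((a i + b i) / 2) ^ w) *
          ∏ i ∈ I, (if i ∈ I then c i / ((a i + b i) / 2) else 0) ^ w := by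
        rw [← Finset.prod_mul_distrib]
        refine Finset.prod_congr rfl fun i hi => ?_
        rw [if_pos hi, ← Real.mul_rpow (hm i hi).le (div_nonneg (hc i) (hm i hi).le),
          mul_div_cancel₀ _ (hm i hi).ne']
      rw [h2]
      refine mul_le_mul_of_nonneg_left ?_
        (Finset.prod_nonneg fun i hi => Real.rpow_nonneg (hm i hi).le _)
      refine h1.trans (le_of_eq ?_)
      rw [add_comm]
      congr 1
      exact Finset.sum_congr rfl fun i hi => by rw [if_pos hi]
    have hA := key a ha
    have hB := key b hb
    have hsum : ∑ i ∈ I, w * (a i / ((a i + b i) / 2)) + ∑ i ∈ I, w * (b i / ((a i + b i) / 2))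
        = 2 * (I.card * w) := by
      rw [← Finset.sum_add_distrib, Finset.sum_congr rfl (g := fun _ => 2 * w)]
      · simp; ring
      · intro i hi
        have := hm i hi
        have h3 := hz i hi
        field_simp
    generalize ∏ i ∈ I, ((a i + b i) / 2) ^ w = P at *
    have : P * (∑ i ∈ I, w * (a i / ((a i + b i) / 2)) + (1 - I.card * w)) +
        P * (∑ i ∈ I, w * (b i / ((a i + b i) / 2)) + (1 - I.card * w)) = 2 * P := by
      rw [← mul_add]
      linear_combination P * hsum
    linarith

/-- Finner's inequality on the discrete cube with equal weights. -/
theorem listAvg_prod_rpow_le {ι : Type*} (I : Finset ι) (h : ι → (V → Bool) → ℝ)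
    (h0 : ∀ i s, 0 ≤ h i s) {w : ℝ} (hw : 0 < w) (J : V → Finset ι) (hJI : ∀ x, J x ⊆ I)
    (hJ : ∀ x, (J x).card * w ≤ 1) (hinv : ∀ x, ∀ i ∈ I, i ∉ J x → CoordInvariant x (h i))
    (l : List V) (s : V → Bool) :
    listAvg l (fun s => ∏ i ∈ I, h i s ^ w) s ≤ ∏ i ∈ I, listAvg l (h i) s ^ w := by
  classical
  induction l generalizing s with
  | nil => exact le_rfl
  | cons x l ih =>
    have h1 := ih (Function.update s x true)
    have h2 := ih (Function.update s x false)
    -- Factors outside `J x` do not see `x` and pull out of the average; the two-point Hölder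
    -- inequality handles the rest.
    have hsplit : ∀ g : ι → ℝ, ∏ i ∈ I, g i = (∏ i ∈ I \ J x, g i) * ∏ i ∈ J x, g i :=
      fun g => (Finset.prod_sdiff (hJI x)).symm
    have hI : ∀ i ∈ I \ J x, ∀ b, listAvg l (h i) (Function.update s x b) = listAvg l (h i) s := by
      intro i hi b
      rw [Finset.mem_sdiff] at hi
      exact (hinv x i hi.1 hi.2).listAvg l s b
    have hconst : ∀ b, ∏ i ∈ I \ J x, listAvg l (h i) (Function.update s x b) ^ w =
        ∏ i ∈ I \ J x, listAvg l (h i) s ^ w := fun b =>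
      Finset.prod_congr rfl fun i hi => by rw [hI i hi]
    have hconst' : ∏ i ∈ I \ J x, listAvg (x :: l) (h i) s ^ w =
        ∏ i ∈ I \ J x, listAvg l (h i) s ^ w :=
      Finset.prod_congr rfl fun i hi => by
        simp only [listAvg, coordAvg]
        rw [hI i hi, hI i hi, add_self_div_two]
    have h3 := prod_rpow_avg_le (J x) (fun i => listAvg l (h i) (Function.update s x true))
      (fun i => listAvg l (h i) (Function.update s x false))
      (fun i => listAvg_nonneg (h0 i) _ _) (fun i => listAvg_nonneg (h0 i) _ _) hw (hJ x)
    have h4 : 0 ≤ ∏ i ∈ I \ J x, listAvg l (h i) s ^ w :=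
      Finset.prod_nonneg fun i _ => Real.rpow_nonneg (listAvg_nonneg (h0 i) _ _) _
    have h5 := mul_le_mul_of_nonneg_left h3 h4
    rw [hsplit, hconst']
    rw [hsplit, hconst] at h1 h2
    refine le_trans ?_ h5
    simp only [listAvg, coordAvg]
    linarith

end Averaging

/-! ### Vertex sets without isolated vertices -/

section Isolated

variable {V : Type*} [Fintype V] [DecidableEq V] (G : SimpleGraph V) [DecidableRel G.Adj]

/-- The vertex `u` is isolated in the subgraph induced by the set with indicator `s`. -/
def IsolatedIn (s : V → Bool) (u : V) : Prop :=
  s u = true ∧ ∀ w, G.Adj u w → s w = false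

instance (s : V → Bool) (u : V) : Decidable (IsolatedIn G s u) :=
  inferInstanceAs (Decidable (_ ∧ _))

variable {G}

omit [Fintype V] [DecidableRel G.Adj] in
theorem isolatedIn_update {x u : V} (hxu : x ≠ u) (hadj : ¬ G.Adj u x) (s : V → Bool) (b : Bool) :
    IsolatedIn G (Function.update s x b) u ↔ IsolatedIn G s u := by
  unfold IsolatedIn
  rw [Function.update_of_ne hxu.symm]
  refine and_congr_right fun _ => forall_congr' fun w => imp_congr_right fun hw => ?_
  rw [Function.update_of_ne]
  rintro rfl
  exact hadj hw

/-- Isolation of `u` prescribes exactly the d + 1 coordinates of its closed neighbourhood. -/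
theorem card_isolatedIn {d : ℕ} (u : V) (hd : G.degree u = d) :
    2 ^ (d + 1) * (Finset.univ.filter fun s : V → Bool => IsolatedIn G s u).card =
      2 ^ Fintype.card V := by
  have h1 : (Finset.univ.filter fun s : V → Bool => IsolatedIn G s u) =
      Fintype.piFinset fun x => if x = u then {true} else if G.Adj u x then {false}
        else Finset.univ := by
    ext s
    rw [Finset.mem_filter, Fintype.mem_piFinset, and_iff_right (Finset.mem_univ s)]
    unfold IsolatedIn
    constructor
    · rintro ⟨h1, h2⟩ x
      split_ifs with hx hx'
      · simp [hx, h1]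
      · simp [h2 x hx']
      · simp
    · intro h
      refine ⟨by simpa using h u, fun w hw => ?_⟩
      simpa [hw, hw.ne'] using h w
  rw [h1, Fintype.card_piFinset]
  have h2 : ∀ x, (if x = u then {true} else if G.Adj u x then {false}
        else (Finset.univ : Finset Bool)).card =
      if x ∈ insert u (G.neighborFinset u) then 1 else 2 := by
    intro x
    by_cases hx : x = u <;> by_cases hx' : G.Adj u x <;> simp [hx, hx']
  simp_rw [h2]
  rw [Finset.prod_ite]
  have h3 : (insert u (G.neighborFinset u)).card = d + 1 := by
    rw [Finset.card_insert_of_notMem (by simp), G.card_neighborFinset_eq_degree, hd]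
  have h4 : (Finset.univ.filter fun x => x ∉ insert u (G.neighborFinset u)).card =
      Fintype.card V - (d + 1) := by
    rw [← h3, ← Finset.card_compl]
    congr 1
    ext x
    simp
  have h5 : d + 1 ≤ Fintype.card V := h3 ▸ Finset.card_le_univ _
  rw [Finset.prod_const, Finset.prod_const, h4, one_pow, one_mul, ← pow_add]
  congr 1
  omega

/-- The indicator that neither end of a pair is isolated in the set with indicator `s`. -/
noncomputable def pairInd (G : SimpleGraph V) [DecidableRel G.Adj] (p : V × V) (s : V → Bool) :
    ℝ :=
  if IsolatedIn G s p.1 ∨ IsolatedIn G s p.2 then 0 else 1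

omit [DecidableEq V] in
theorem pairInd_nonneg (p : V × V) (s : V → Bool) : 0 ≤ pairInd G p s := by
  unfold pairInd
  split_ifs <;> norm_num

/-- An isolated vertex is in the set and its neighbours are not, so the two isolation events are
disjoint and their probabilities 2^(-(d+1)) add. -/
theorem sum_pairInd {d : ℕ} (hG : G.IsRegularOfDegree d) {p : V × V} (hp : G.Adj p.1 p.2) :
    ∑ s, pairInd G p s = 2 ^ Fintype.card V * (1 - (1 / 2) ^ d) := by
  have h1 : ∀ s, pairInd G p s =
      1 - ((if IsolatedIn G s p.1 then 1 else 0) + if IsolatedIn G s p.2 then 1 else 0) := by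
    intro s
    unfold pairInd
    by_cases h1 : IsolatedIn G s p.1 <;> by_cases h2 : IsolatedIn G s p.2
    · have := h1.2 _ hp
      rw [h2.1] at this
      simp at this
    all_goals simp [h1, h2]
  have h2 : ∀ u, ∑ s : V → Bool, (if IsolatedIn G s u then (1 : ℝ) else 0) =
      2 ^ Fintype.card V * (1 / 2) ^ (d + 1) := by
    intro u
    have h3 := card_isolatedIn u (hG u)
    rw [Finset.sum_boole, ← Nat.cast_two, ← Nat.cast_pow, ← h3]
    push_cast
    rw [mul_right_comm, ← mul_pow]
    norm_num
  simp_rw [h1]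
  rw [Finset.sum_sub_distrib, Finset.sum_add_distrib, h2, h2]
  simp
  ring

omit [DecidableEq V] in
theorem card_adj_pairs {d : ℕ} (hG : G.IsRegularOfDegree d) :
    (Finset.univ.filter fun p : V × V => G.Adj p.1 p.2).card = Fintype.card V * d := by
  rw [Finset.card_filter, ← Finset.univ_product_univ, Finset.sum_product]
  have : ∀ x, ∑ y, (if G.Adj x y then 1 else 0) = d := by
    intro x
    rw [← Finset.card_filter, ← hG x, ← G.card_neighborFinset_eq_degree]
    congr 1
    ext y
    simp
  simp [this]

/-- In a cubic graph at most 18 ordered pairs of adjacent vertices have a given vertex in the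
union of their closed neighbourhoods. -/
theorem card_adj_pairs_near_le (hG : G.IsRegularOfDegree 3) (x : V) :
    (Finset.univ.filter fun p : V × V => G.Adj p.1 p.2 ∧
      (x = p.1 ∨ G.Adj p.1 x ∨ x = p.2 ∨ G.Adj p.2 x)).card ≤ 18 := by
  have hN : ∀ y, (G.neighborFinset y).card = 3 := fun y => by
    rw [G.card_neighborFinset_eq_degree, hG y]
  -- `A` and `A'` hold the pairs with end `x`, at most 3 per orientation; `B` and `B'` hold those
  -- with an end next to `x` and the other end different from `x`, at most 3 · 2 per orientation.
  let A := (G.neighborFinset x).image fun y => (x, y)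
  let A' := (G.neighborFinset x).image fun y => (y, x)
  let B := (G.neighborFinset x).biUnion fun y => ((G.neighborFinset y).erase x).image fun z => (y, z)
  let B' := (G.neighborFinset x).biUnion fun y => ((G.neighborFinset y).erase x).image fun z => (z, y)
  have hsub : (Finset.univ.filter fun p : V × V => G.Adj p.1 p.2 ∧
      (x = p.1 ∨ G.Adj p.1 x ∨ x = p.2 ∨ G.Adj p.2 x)) ⊆ (A ∪ A') ∪ (B ∪ B') := by
    rintro ⟨u, v⟩ h
    simp only [Finset.mem_filter, Finset.mem_univ, true_and] at h
    obtain ⟨huv, h⟩ := h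
    simp only [A, A', B, B', Finset.mem_union, Finset.mem_image, Finset.mem_biUnion,
      Finset.mem_erase, SimpleGraph.mem_neighborFinset, Prod.mk.injEq]
    by_cases hxu : x = u
    · exact Or.inl (Or.inl ⟨v, hxu ▸ huv, hxu, rfl⟩)
    by_cases hxv : x = v
    · exact Or.inl (Or.inr ⟨u, hxv ▸ huv.symm, rfl, hxv⟩)
    rcases h with h | h | h | h
    · exact absurd h hxu
    · exact Or.inr (Or.inl ⟨u, h.symm, v, ⟨Ne.symm hxv, huv⟩, rfl, rfl⟩)
    · exact absurd h hxv
    · exact Or.inr (Or.inr ⟨v, h.symm, u, ⟨Ne.symm hxu, huv.symm⟩, rfl, rfl⟩)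
  have hA : A.card ≤ 3 := Finset.card_image_le.trans (hN x).le
  have hA' : A'.card ≤ 3 := Finset.card_image_le.trans (hN x).le
  have hE : ∀ y ∈ G.neighborFinset x, ((G.neighborFinset y).erase x).card ≤ 2 := by
    intro y hy
    rw [Finset.card_erase_of_mem (by simpa [G.adj_comm] using hy), hN]
  have hB : B.card ≤ 3 * 2 := by
    rw [← hN x]
    exact Finset.card_biUnion_le_card_mul _ _ _ fun y hy => Finset.card_image_le.trans (hE y hy)
  have hB' : B'.card ≤ 3 * 2 := by
    rw [← hN x]
    exact Finset.card_biUnion_le_card_mul _ _ _ fun y hy => Finset.card_image_le.trans (hE y hy)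
  have h1 := Finset.card_le_card hsub
  have h2 := Finset.card_union_le (A ∪ A') (B ∪ B')
  have h3 := Finset.card_union_le A A'
  have h4 := Finset.card_union_le B B'
  omega

/-- Number of vertex sets without isolated vertices in a cubic graph. -/
theorem card_no_isolated_le (hG : G.IsRegularOfDegree 3) :
    ((Finset.univ.filter fun s : V → Bool => ∀ u, ¬ IsolatedIn G s u).card : ℝ) ≤
      2 ^ Fintype.card V * (7 / 8 : ℝ) ^ ((Fintype.card V : ℝ) / 6) := by
  set I := Finset.univ.filter fun p : V × V => G.Adj p.1 p.2 with hI
  have hw : (0 : ℝ) < 1 / 18 := by norm_num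
  have hF := listAvg_prod_rpow_le I (pairInd G) pairInd_nonneg hw
    (fun x => Finset.univ.filter fun p : V × V => G.Adj p.1 p.2 ∧
      (x = p.1 ∨ G.Adj p.1 x ∨ x = p.2 ∨ G.Adj p.2 x))
    (fun x p hp => by
      simp only [Finset.mem_filter] at hp
      simp [hI, hp.2.1])
    (fun x => by
      have : ((Finset.univ.filter fun p : V × V => G.Adj p.1 p.2 ∧
        (x = p.1 ∨ G.Adj p.1 x ∨ x = p.2 ∨ G.Adj p.2 x)).card : ℝ) ≤ 18 := by
        exact_mod_cast card_adj_pairs_near_le hG x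
      linarith)
    (fun x p hp hpx s b => by
      simp only [hI, Finset.mem_filter, Finset.mem_univ, true_and] at hp hpx
      push Not at hpx
      obtain ⟨h1, h2, h3, h4⟩ := hpx hp
      unfold pairInd
      simp only [isolatedIn_update h1 h2, isolatedIn_update h3 h4])
    Finset.univ.toList (fun _ => false)
  have hpos : (0 : ℝ) < 2 ^ Fintype.card V := by positivity
  have hmean : ∀ p ∈ I, listAvg Finset.univ.toList (pairInd G p) (fun _ => false) = 7 / 8 := by
    intro p hp
    have h1 := two_pow_mul_listAvg_univ (pairInd G p) (fun _ => false)
    rw [sum_pairInd hG (by simpa [hI] using hp)] at h1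
    rw [mul_left_cancel₀ hpos.ne' h1]
    norm_num
  rw [Finset.prod_congr rfl fun p hp => by rw [hmean p hp], Finset.prod_const, card_adj_pairs hG,
    ← Real.rpow_natCast, ← Real.rpow_mul (by norm_num)] at hF
  have hexp : (1 / 18 : ℝ) * ((Fintype.card V * 3 : ℕ) : ℝ) = (Fintype.card V : ℝ) / 6 := by
    push_cast
    ring
  rw [hexp] at hF
  refine le_trans ?_ (mul_le_mul_of_nonneg_left hF hpos.le)
  rw [two_pow_mul_listAvg_univ, Finset.card_filter]
  push_cast
  refine Finset.sum_le_sum fun s _ => ?_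
  split_ifs with hs
  · rw [Finset.prod_eq_one]
    intro p _
    simp [pairInd, hs]
  · exact Finset.prod_nonneg fun p _ => Real.rpow_nonneg (pairInd_nonneg p s) _

end Isolated

/-- A connected set with more than one vertex has no isolated vertex. -/
theorem exists_adj_of_induce_connected {V : Type*} {G : SimpleGraph V} {S : Set V}
    (hS : (G.induce S).Connected) (hn : S.Nontrivial) {u : V} (hu : u ∈ S) :
    ∃ w ∈ S, G.Adj u w := by
  have : Nontrivial S := Set.nontrivial_coe_sort.2 hn
  obtain ⟨w, hw⟩ := hS.preconnected.exists_adj_of_nontrivial ⟨u, hu⟩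
  exact ⟨w, w.2, hw⟩

/-- The summand linear in the order accounts for the singletons, the only connected sets with an
isolated vertex. -/
theorem numConnectedSets_le_of_cubic {V : Type*} [Fintype V] [DecidableEq V] {G : SimpleGraph V}
    [DecidableRel G.Adj] (hG : G.IsRegularOfDegree 3) :
    (numConnectedSets G : ℝ) ≤
      Fintype.card V + 2 ^ Fintype.card V * (7 / 8 : ℝ) ^ ((Fintype.card V : ℝ) / 6) := by
  classical
  refine le_trans ?_ (add_le_add_right (card_no_isolated_le hG) _)
  set F := Finset.univ.filter fun s : V → Bool => ∀ u, ¬ IsolatedIn G s u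
  have hsub : {S : Set V | (G.induce S).Connected} ⊆
      ((Finset.univ.image fun v : V => ({v} : Set V)) ∪
        F.image fun s => {v | s v = true} : Finset (Set V)) := by
    intro S hS
    rw [Set.mem_ofPred_eq] at hS
    simp only [Finset.coe_union, Finset.coe_image, Set.mem_union, Set.mem_image]
    obtain ⟨⟨v, hv⟩⟩ := hS.nonempty
    rcases Set.eq_singleton_or_nontrivial hv with h | h
    · exact Or.inl ⟨v, by simp, h.symm⟩
    · refine Or.inr ⟨fun v => decide (v ∈ S), ?_, by simp⟩
      rw [Finset.mem_coe, Finset.mem_filter, and_iff_right (Finset.mem_univ _)]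
      rintro u ⟨hu, hu'⟩
      obtain ⟨w, hw, huw⟩ := exists_adj_of_induce_connected hS h (of_decide_eq_true hu)
      have := hu' w huw
      simp [hw] at this
  have h1 := Set.ncard_le_ncard hsub (Finset.finite_toSet _)
  rw [Set.ncard_coe_finset] at h1
  have h2 : numConnectedSets G ≤ Fintype.card V + F.card :=
    h1.trans ((Finset.card_union_le _ _).trans
      (add_le_add (Finset.card_image_le.trans le_rfl) Finset.card_image_le))
  exact_mod_cast h2

/-! ### Invariance under isomorphism -/

section Transport

variable {V W : Type*} {G : SimpleGraph V} {H : SimpleGraph W}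

theorem numConnectedSets_le_of_iso [Finite W] (φ : G ≃g H) :
    numConnectedSets G ≤ numConnectedSets H := by
  refine Set.ncard_le_ncard_of_injOn (fun S => φ '' S) ?_ ?_ (Set.toFinite _)
  · intro S hS
    exact (φ.induce φ.injective.injOn.bijOn_image).connected_iff.1 hS
  · exact (Set.image_injective.2 φ.injective).injOn

theorem numConnectedSets_congr [Finite V] [Finite W] (φ : G ≃g H) :
    numConnectedSets G = numConnectedSets H :=
  (numConnectedSets_le_of_iso φ).antisymm (numConnectedSets_le_of_iso φ.symm)

/-- A finite connected regular graph on any vertex type is isomorphic to one on some `Fin n`. -/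
theorem exists_connRegularGraph [Fintype V] [DecidableRel G.Adj] {d : ℕ} (hc : G.Connected)
    (hd : G.IsRegularOfDegree d) :
    ∃ K : ConnRegularGraph d, K.order = Fintype.card V ∧ connGrowth K.graph = connGrowth G := by
  classical
  let φ : G ≃g G.map (Fintype.equivFin V) := SimpleGraph.Iso.map _ G
  refine ⟨⟨Fintype.card V, G.map (Fintype.equivFin V), φ.connected_iff.1 hc, fun v => ?_⟩, rfl, ?_⟩
  · obtain ⟨u, rfl⟩ := φ.surjective v
    rw [← hd u]
    convert φ.degree_eq u
  · simp only [connGrowth]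
    rw [← numConnectedSets_congr φ]
    simp

end Transport

/-! ### The ring of blocks and its connected sets -/

section Necklace

/-- The neighbourhoods in the block graph, as bit masks. -/
def blockMask : Fin 10 → ℕ
  | 0 => 0b10010
  | 1 => 0b1001
  | 2 => 0b1011000000
  | 3 => 0b1100010
  | 4 => 0b1100000001
  | 5 => 0b1010001000
  | 6 => 0b100001100
  | 7 => 0b100100100
  | 8 => 0b11010000
  | 9 => 0b110100

/-- A graph on 10 vertices in which the vertices 0 and 1 have degree two, the others three. -/
def blockAdj (a b : Fin 10) : Bool := (blockMask a).testBit b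

theorem blockAdj_comm (a b : Fin 10) : blockAdj a b = blockAdj b a := by
  revert a b
  decide

theorem blockAdj_self (a : Fin 10) : blockAdj a a = false := by
  revert a
  decide

/-- The union of the neighbourhoods of those vertices of `l` that lie in `r`. -/
def blockSpread (r : ℕ) : List (Fin 10) → ℕ
  | [] => 0
  | i :: l => (if r.testBit i then blockMask i else 0) ||| blockSpread r l

/-- The vertices of `s` within distance `k` of the vertex 0 in the graph induced by `s`. -/
def blockBall (s : ℕ) : ℕ → ℕ
  | 0 => 1
  | k + 1 => blockBall s k ||| (s &&& blockSpread (blockBall s k) (List.finRange 10))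

/-- The mask `s` describes a connected set of the block graph that contains 0 and 1. -/
def IsLinking (s : ℕ) : Bool :=
  -- Radius 8 suffices: an induced distance of 9 would force the whole block to be a path. The lower
  -- bound only needs that such masks are connected.
  s.testBit 0 && s.testBit 1 && (s == blockBall s 8)

/-- The masks of connected sets of the block graph that contain 0 and 1. -/
def linkingMasks : Finset ℕ := (Finset.range 1024).filter fun s => IsLinking s

theorem card_linkingMasks : linkingMasks.card = 134 := by
  decide +kernel

theorem full_mem_linkingMasks : 1023 ∈ linkingMasks := by
  decide +kernel

theorem testBit_blockSpread {r : ℕ} {l : List (Fin 10)} {a : Fin 10}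
    (h : (blockSpread r l).testBit a = true) : ∃ i : Fin 10, r.testBit i ∧ blockAdj i a := by
  induction l with
  | nil => simp [blockSpread] at h
  | cons i l ih =>
    rw [blockSpread, Nat.testBit_or, Bool.or_eq_true] at h
    rcases h with h | h
    · split_ifs at h with hi
      · exact ⟨i, hi, h⟩
      · simp at h
    · exact ih h

variable (m : ℕ)

/-- A ring of `m` copies of the block graph, the vertex 0 of each joined to the vertex 1 of the
next. -/
def necklace [Nontrivial (ZMod m)] : SimpleGraph (ZMod m × Fin 10) where
  Adj p q := (p.1 = q.1 ∧ blockAdj p.2 q.2) ∨ (p.2 = 0 ∧ q.2 = 1 ∧ q.1 = p.1 + 1) ∨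
    (p.2 = 1 ∧ q.2 = 0 ∧ p.1 = q.1 + 1)
  symm := by
    constructor
    rintro ⟨i, a⟩ ⟨j, b⟩ h
    simp only at h ⊢
    rw [blockAdj_comm]
    tauto
  loopless := by
    constructor
    rintro ⟨i, a⟩ h
    simp [blockAdj_self] at h

variable {m} [Nontrivial (ZMod m)]

/-- The vertex set whose trace on each copy of the block is given by a mask. -/
def necklaceSet (f : ZMod m → ℕ) : Set (ZMod m × Fin 10) := {p | (f p.1).testBit p.2 = true}

omit [Nontrivial (ZMod m)] in
theorem mem_necklaceSet {f : ZMod m → ℕ} {p : ZMod m × Fin 10} :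
    p ∈ necklaceSet f ↔ (f p.1).testBit p.2 = true := Iff.rfl

omit [Nontrivial (ZMod m)] in
theorem necklaceSet_injOn :
    Set.InjOn (necklaceSet (m := m)) {f | ∀ i, f i ∈ linkingMasks} := by
  intro f hf g hg h
  funext i
  have hlt : ∀ {f : ZMod m → ℕ}, (∀ i, f i ∈ linkingMasks) → f i < 2 ^ 10 := fun hf =>
    Finset.mem_range.1 (Finset.mem_filter.1 (hf i)).1
  refine Nat.eq_of_testBit_eq fun k => ?_
  by_cases hk : k < 10
  · have := Set.ext_iff.1 h (i, ⟨k, hk⟩)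
    rw [mem_necklaceSet, mem_necklaceSet] at this
    exact Bool.eq_iff_iff.2 this
  · have h10 : 2 ^ 10 ≤ 2 ^ k := Nat.pow_le_pow_right (by norm_num) (not_lt.1 hk)
    rw [Nat.testBit_lt_two_pow ((hlt hf).trans_le h10),
      Nat.testBit_lt_two_pow ((hlt hg).trans_le h10)]

/-- Within a block everything is reachable from port 0, by induction on the ball radius. Port 0 of
each block is joined to port 1 of the next, so walking round the ring reaches every block. -/
theorem necklaceSet_connected [NeZero m] {f : ZMod m → ℕ} (hf : ∀ i, f i ∈ linkingMasks) :
    ((necklace m).induce (necklaceSet f)).Connected := by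
  have hlink : ∀ i, (f i).testBit 0 = true ∧ (f i).testBit 1 = true ∧
      f i = blockBall (f i) 8 := by
    intro i
    have := (Finset.mem_filter.1 (hf i)).2
    simpa [IsLinking, and_assoc] using this
  have h0 : ∀ i, (i, (0 : Fin 10)) ∈ necklaceSet f := fun i => (hlink i).1
  have h1 : ∀ i, (i, (1 : Fin 10)) ∈ necklaceSet f := fun i => (hlink i).2.1
  have hball : ∀ i k (a : Fin 10), (blockBall (f i) k).testBit a = true →
      ∃ h : (i, a) ∈ necklaceSet f,
        ((necklace m).induce (necklaceSet f)).Reachable ⟨_, h0 i⟩ ⟨_, h⟩ := by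
    intro i k
    induction k with
    | zero =>
      intro a ha
      have : a = 0 := by
        rw [blockBall] at ha
        revert a
        decide
      subst this
      exact ⟨h0 i, SimpleGraph.Reachable.refl _⟩
    | succ k ih =>
      intro a ha
      rw [blockBall, Nat.testBit_or, Bool.or_eq_true, Nat.testBit_and, Bool.and_eq_true] at ha
      rcases ha with ha | ⟨ha, ha'⟩
      · exact ih a ha
      · obtain ⟨b, hb, hba⟩ := testBit_blockSpread ha'
        obtain ⟨hb', hr⟩ := ih b hb
        refine ⟨ha, hr.trans (SimpleGraph.Adj.reachable ?_)⟩
        exact Or.inl ⟨rfl, hba⟩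
  have hblock : ∀ i (a : Fin 10) (h : (i, a) ∈ necklaceSet f),
      ((necklace m).induce (necklaceSet f)).Reachable ⟨_, h0 i⟩ ⟨_, h⟩ := by
    intro i a h
    have h' := mem_necklaceSet.1 h
    rw [(hlink i).2.2] at h'
    exact (hball i 8 a h').2
  have hring : ∀ k : ℕ, ((necklace m).induce (necklaceSet f)).Reachable
      ⟨_, h0 0⟩ ⟨_, h0 (k : ZMod m)⟩ := by
    intro k
    induction k with
    | zero => simp
    | succ k ih =>
      refine ih.trans (SimpleGraph.Reachable.trans (SimpleGraph.Adj.reachable ?_)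
        (hblock _ _ (h1 _)).symm)
      exact Or.inr (Or.inl ⟨rfl, rfl, by push_cast; rfl⟩)
  rw [SimpleGraph.connected_iff_exists_forall_reachable]
  refine ⟨⟨_, h0 0⟩, ?_⟩
  rintro ⟨⟨i, a⟩, h⟩
  have := hring i.val
  simp only [ZMod.natCast_zmod_val] at this
  exact this.trans (hblock i a h)

theorem necklace_connected [NeZero m] : (necklace m).Connected := by
  have h := necklaceSet_connected (m := m) (f := fun _ => 1023) fun _ => full_mem_linkingMasks
  have huniv : necklaceSet (m := m) (fun _ => 1023) = Set.univ := by
    ext ⟨i, a⟩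
    rw [mem_necklaceSet]
    simp only [Set.mem_univ, iff_true]
    revert a
    decide
  rw [huniv] at h
  exact (SimpleGraph.induceUnivIso _).connected_iff.1 h

theorem pow_le_numConnectedSets_necklace [NeZero m] :
    134 ^ m ≤ numConnectedSets (necklace m) := by
  classical
  have h : ((Fintype.piFinset fun _ : ZMod m => linkingMasks : Finset (ZMod m → ℕ)) :
      Set (ZMod m → ℕ)).ncard ≤ numConnectedSets (necklace m) := by
    refine Set.ncard_le_ncard_of_injOn necklaceSet ?_ ?_ (Set.toFinite _)
    · intro f hf
      exact necklaceSet_connected (by simpa using hf)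
    · exact necklaceSet_injOn.mono fun f hf => by simpa using hf
  rw [Set.ncard_coe_finset, Fintype.card_piFinset] at h
  simpa [card_linkingMasks, ZMod.card] using h

open Classical in
theorem necklace_regular [NeZero m] : (necklace m).IsRegularOfDegree 3 := by
  rintro ⟨i, a⟩
  let A : Finset (ZMod m × Fin 10) := (Finset.univ.filter fun b => blockAdj a b).image fun b => (i, b)
  let B : Finset (ZMod m × Fin 10) :=
    if a = 0 then {(i + 1, 1)} else if a = 1 then {(i - 1, 0)} else ∅
  have hN : (necklace m).neighborFinset (i, a) = A ∪ B := by
    ext ⟨j, b⟩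
    rw [SimpleGraph.mem_neighborFinset]
    simp only [necklace, A, B, Finset.mem_union, Finset.mem_image,
      Finset.mem_filter, Finset.mem_univ, true_and, Prod.mk.injEq]
    refine or_congr ⟨fun h => ⟨b, h.2, h.1, rfl⟩, ?_⟩ ?_
    · rintro ⟨c, hc, hij, rfl⟩
      exact ⟨hij, hc⟩
    · by_cases h0 : a = 0
      · simp [h0, and_comm]
      · by_cases h1 : a = 1
        · simp [h1, and_comm, eq_sub_iff_add_eq, eq_comm]
        · simp [h0, h1]
  have hdisj : Disjoint A B := by
    rw [Finset.disjoint_left]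
    intro p hA hB
    obtain ⟨b, -, rfl⟩ := Finset.mem_image.1 hA
    simp only [B] at hB
    -- Ports 0 and 1 lie in different blocks when joined across the ring, because i + 1 ≠ i in a
    -- nontrivial `ZMod m`.
    split_ifs at hB <;> simp [eq_sub_iff_add_eq] at hB
  have hA : A.card = (Finset.univ.filter fun b => blockAdj a b).card :=
    Finset.card_image_of_injective _ fun b c h => (Prod.mk.inj h).2
  have hB : B.card = if a = 0 then 1 else if a = 1 then 1 else 0 := by
    simp only [B]
    split_ifs <;> simp
  rw [← SimpleGraph.card_neighborFinset_eq_degree, hN, Finset.card_union_of_disjoint hdisj, hA, hB]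
  clear hN hdisj hA hB A B
  revert a
  decide

end Necklace

/-! ### Passage to the limit superior -/

theorem frequently_le_connGrowth_cubic :
    ∃ᶠ G : ConnRegularGraph 3 in comap (fun G : ConnRegularGraph 3 => G.order) atTop,
      (1 / 2) * (134 : ℝ) ^ (1 / 10 : ℝ) ≤ connGrowth G.graph := by
  classical
  rw [frequently_comap, frequently_atTop]
  intro N
  have : Fact (1 < N + 2) := ⟨by omega⟩
  have : Nontrivial (ZMod (N + 2)) := ZMod.nontrivial _
  obtain ⟨K, hK, hK'⟩ := exists_connRegularGraph (necklace_connected (m := N + 2)) necklace_regular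
  have hcard : Fintype.card (ZMod (N + 2) × Fin 10) = (N + 2) * 10 := by
    rw [Fintype.card_prod, ZMod.card, Fintype.card_fin]
  refine ⟨K.order, by omega, K, rfl, ?_⟩
  rw [hK', connGrowth, Nat.card_eq_fintype_card, hcard]
  refine mul_le_mul_of_nonneg_left ?_ (by norm_num)
  have h1 : (134 : ℝ) ^ (N + 2) ≤ numConnectedSets (necklace (N + 2)) := by
    exact_mod_cast pow_le_numConnectedSets_necklace
  refine le_trans (le_of_eq ?_) (Real.rpow_le_rpow (by positivity) h1 (by positivity))
  rw [← Real.rpow_natCast, ← Real.rpow_mul (by norm_num)]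
  congr 1
  push_cast
  field_simp

theorem eventually_connGrowth_cubic_le :
    ∀ᶠ G : ConnRegularGraph 3 in comap (fun G : ConnRegularGraph 3 => G.order) atTop,
      connGrowth G.graph ≤ 0.97805 := by
  classical
  have hq : (7 / 8 : ℝ) ^ (1 / 6 : ℝ) ≤ 0.978 := by
    rw [one_div, Real.rpow_inv_le_iff_of_pos] <;> norm_num
  -- Here 1.956 = 2 · 0.978, and the slightly larger base 1.9561 = 2 · 0.97805 absorbs the linear
  -- term from the singletons.
  have hlim : Tendsto (fun n : ℕ => n * (1 / 1.9561 : ℝ) ^ n + (1.956 / 1.9561 : ℝ) ^ n) atTop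
      (nhds (0 + 0)) :=
    (tendsto_self_mul_const_pow_of_lt_one (by norm_num) (by norm_num)).add
      (tendsto_pow_atTop_nhds_zero_of_lt_one (by norm_num) (by norm_num))
  have hev : ∀ᶠ n : ℕ in atTop, 1 ≤ n ∧ (n : ℝ) + 1.956 ^ n ≤ 1.9561 ^ n := by
    filter_upwards [hlim.eventually_lt_const (by norm_num : (0 + 0 : ℝ) < 1),
      eventually_ge_atTop 1] with n hn h1
    refine ⟨h1, ?_⟩
    have h2 : (0 : ℝ) < 1.9561 ^ n := by positivity
    rw [div_pow, div_pow, one_pow, mul_one_div, ← add_div, div_lt_one h2] at hn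
    exact hn.le
  rw [eventually_comap]
  filter_upwards [hev] with n hn G hG
  subst hG
  have h1 := numConnectedSets_le_of_cubic (G := G.graph) (fun v => by convert G.regular v)
  rw [Fintype.card_fin] at h1
  have h2 : (7 / 8 : ℝ) ^ ((G.order : ℝ) / 6) ≤ 0.978 ^ G.order := by
    rw [show (G.order : ℝ) / 6 = 1 / 6 * G.order by ring, Real.rpow_mul (by norm_num),
      Real.rpow_natCast]
    exact pow_le_pow_left₀ (by positivity) hq _
  have h3 : (numConnectedSets G.graph : ℝ) ≤ 1.9561 ^ G.order := by
    refine h1.trans (le_trans ?_ hn.2)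
    have h4 : (1.956 : ℝ) ^ G.order = 2 ^ G.order * 0.978 ^ G.order := by
      rw [← mul_pow]
      norm_num
    rw [h4]
    gcongr
  have h5 := Real.rpow_le_rpow (by positivity) h3 (by positivity : 0 ≤ 1 / (G.order : ℝ))
  have h6 : (G.order : ℝ) ≠ 0 := by
    have := hn.1
    positivity
  rw [← Real.rpow_natCast, ← Real.rpow_mul (by norm_num), mul_one_div_cancel h6,
    Real.rpow_one] at h5
  rw [connGrowth, Nat.card_fin]
  linarith

theorem mainTheorem4 :
    0.813 < regularGrowthConst 3 ∧ regularGrowthConst 3 < 0.9781 := by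
  have hfreq := frequently_le_connGrowth_cubic
  have hev := eventually_connGrowth_cubic_le
  constructor
  · have h1 : (0.813 : ℝ) < (1 / 2) * (134 : ℝ) ^ (1 / 10 : ℝ) := by
      have : (1.626 : ℝ) < (134 : ℝ) ^ (1 / 10 : ℝ) := by
        rw [one_div, Real.lt_rpow_inv_iff_of_pos] <;> norm_num
      linarith
    -- A real `limsup` is meaningful only for bounded families: the upper estimate supplies
    -- boundedness here, and the lower one coboundedness for the other half.
    exact h1.trans_le (le_limsup_of_frequently_le hfreq (isBoundedUnder_of_eventually_le hev))
  · have h2 : regularGrowthConst 3 ≤ 0.97805 :=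
      limsup_le_of_le (IsCoboundedUnder.of_frequently_ge hfreq) hev
    exact h2.trans_lt (by norm_num)
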